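/- Let $-\infty<a<b<\infty$, $n\in\mathbb N$, and let $K:[a,b]\times[a,b]\to\mathbb C^{n\times n}$ be continuous. For $\xi\in[a,b]$ consider the truncated matrix equations on $[a,\xi]$, with continuous $n\times n$ matrix unknowns $g(\cdot,\xi)$ and $g^*(\cdot,\xi)$, $$g(t,\xi)-\int_a^\xi K(t,s)\,g(s,\xi)\,ds=I,\qquad g^*(t,\xi)-\int_a^\xi g^*(s,\xi)\,K(s,t)\,ds=I\qquad(a\le t\le\xi)$$ (for $\xi=a$ they just say $g(a,a)=g^*(a,a)=I$). Suppose that for every $\xi\in(a,b]$ the first equation has a unique continuous solution $g(\cdot,\xi)$. Then for every $\xi\in(a,b]$ the second equation also has a unique continuous solution $g^*(\cdot,\xi)$. Suppose moreover that $\det[g^*(\xi,\xi)\,g(\xi,\xi)]\ne0$ for all $\xi\in[a,b]$, and put $M(\xi)=\int_a^\xi g(t,\xi)\,dt$. Then $M$ is differentiable on $[a,b]$ (one-sidedly at the endpoints, as for all derivatives below) and $M'(\xi)$ is invertible for every $\xi\in[a,b]$. For every continuous $f:[a,b]\to\mathbb C^n$ the function $\xi\mapsto\int_a^\xi g^*(s,\xi)f(s)\,ds$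 is differentiable on $[a,b]$, and, with $$F(\xi)=[M'(\xi)]^{-1}\,\frac{d}{d\xi}\int_a^\xi g^*(s,\xi)f(s)\,ds ,$$ the system $$\varphi(t)-\int_a^bK(t,s)\varphi(s)\,ds=f(t)\qquad(a\le t\le b)$$ has a unique continuous solution $\varphi$, given for all $t\in[a,b]$ by $$\varphi(t)=g(t,b)\,[M'(b)]^{-1}\Bigl[\frac{d}{d\xi}\int_a^\xi g^*(s,\xi)f(s)\,ds\Bigr]_{\xi=b}-\int_t^b g(t,\xi)\,dF(\xi),$$ where the last integral exists as a Riemann–Stieltjes integral (limit of the sums $\sum_i g(t,\tau_i)(F(x_{i+1})-F(x_i))$ over tagged partitions of $[t,b]$ as the mesh tends to $0$). If $F$ is absolutely continuous on $[a,b]$, then $F$ is differentiable almost everywhere on $[a,b]$, the function $\xi\mapsto g(t,\xi)\frac{d}{d\xi}F(\xi)$ is integrable on $[t,b]$ for every $t\in[a,b]$, and the last integral may be written $\int_t^b g(t,\xi)\,\frac{d}{d\xi}F(\xi)\,d\xi$, i.e. $$\varphi(t)=g(t,b)\,[M'(b)]^{-1}\Bigl[\frac{d}{d\xi}\int_a^\xi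 g^*(s,\xi)f(s)\,ds\Bigr]_{\xi=b}-\int_t^b g(t,\xi)\,\frac{d}{d\xi}\Bigl\{[M'(\xi)]^{-1}\frac{d}{d\xi}\int_a^\xi g^*(s,\xi)f(s)\,ds\Bigr\}d\xi .$$ -/

import Mathlib

open Set MeasureTheory
open scoped Matrix Matrix.Norms.L2Operator

noncomputable section

namespace KreinSystem

variable {n : ℕ}

/-- `φ` is a continuous solution on `[a,b]` of `φ(t) - ∫_a^b K(t,s) φ(s) ds = f(t)`. -/
def IsSystemSol (K : ℝ → ℝ → Matrix (Fin n) (Fin n) ℂ) (a b : ℝ) (f φ : ℝ → Fin n → ℂ) : Prop :=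
  ContinuousOn φ (Icc a b) ∧
    ∀ t ∈ Icc a b, φ t - ∫ s in a..b, K t s *ᵥ φ s = f t

/-- `h` is a continuous solution on `[a,ξ]` of `h(t) - ∫_a^ξ K(t,s) h(s) ds = I`. -/
def IsTruncSol (K : ℝ → ℝ → Matrix (Fin n) (Fin n) ℂ) (a ξ : ℝ)
    (h : ℝ → Matrix (Fin n) (Fin n) ℂ) : Prop :=
  ContinuousOn h (Icc a ξ) ∧
    ∀ t ∈ Icc a ξ, h t - ∫ s in a..ξ, K t s * h s = 1

/-- `h` is a continuous solution on `[a,ξ]` of `h(t) - ∫_a^ξ h(s) K(s,t) ds = I`. -/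
def IsTruncSolStar (K : ℝ → ℝ → Matrix (Fin n) (Fin n) ℂ) (a ξ : ℝ)
    (h : ℝ → Matrix (Fin n) (Fin n) ℂ) : Prop :=
  ContinuousOn h (Icc a ξ) ∧
    ∀ t ∈ Icc a ξ, h t - ∫ s in a..ξ, h s * K s t = 1

/-- `M(ξ) = ∫_a^ξ g(t,ξ) dt`. -/
def M (a : ℝ) (g : ℝ → ℝ → Matrix (Fin n) (Fin n) ℂ) (ξ : ℝ) : Matrix (Fin n) (Fin n) ℂ :=
  ∫ t in a..ξ, g t ξ

/-- `M'(ξ)` for `ξ ∈ [a,b]`, one-sided at the endpoints. -/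
def M' (a b : ℝ) (g : ℝ → ℝ → Matrix (Fin n) (Fin n) ℂ) (ξ : ℝ) : Matrix (Fin n) (Fin n) ℂ :=
  derivWithin (M a g) (Icc a b) ξ

/-- `G(ξ) = ∫_a^ξ g*(s,ξ) f(s) ds`. -/
def G (a : ℝ) (gs : ℝ → ℝ → Matrix (Fin n) (Fin n) ℂ) (f : ℝ → Fin n → ℂ) (ξ : ℝ) : Fin n → ℂ :=
  ∫ s in a..ξ, gs s ξ *ᵥ f s

/-- `G'(ξ)` for `ξ ∈ [a,b]`, one-sided at the endpoints. -/
def G' (a b : ℝ) (gs : ℝ → ℝ → Matrix (Fin n) (Fin n) ℂ) (f : ℝ → Fin n → ℂ) (ξ : ℝ) :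
    Fin n → ℂ :=
  derivWithin (G a gs f) (Icc a b) ξ

/-- `F(ξ) = [M'(ξ)]⁻¹ (d/dξ) ∫_a^ξ g*(s,ξ) f(s) ds`. -/
def F (a b : ℝ) (g gs : ℝ → ℝ → Matrix (Fin n) (Fin n) ℂ) (f : ℝ → Fin n → ℂ) (ξ : ℝ) :
    Fin n → ℂ :=
  (M' a b g ξ)⁻¹ *ᵥ G' a b gs f ξ

/-- `v` is the Riemann–Stieltjes integral `∫_c^d A(ξ) dF(ξ)`: the limit of the sums
`∑ A(τᵢ) (F(xᵢ₊₁) - F(xᵢ))` over tagged partitions `c = x₀ ≤ τ₀ ≤ x₁ ≤ … ≤ x_N = d` as the mesh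
tends to zero. -/
def IsStieltjesIntegral (A : ℝ → Matrix (Fin n) (Fin n) ℂ) (F : ℝ → Fin n → ℂ) (c d : ℝ)
    (v : Fin n → ℂ) : Prop :=
  ∀ ε > 0, ∃ δ > 0, ∀ (N : ℕ) (x τ : ℕ → ℝ), x 0 = c → x N = d →
    (∀ i < N, x i ≤ τ i ∧ τ i ≤ x (i + 1) ∧ x (i + 1) - x i < δ) →
    ‖(∑ i ∈ Finset.range N, A (τ i) *ᵥ (F (x (i + 1)) - F (x i))) - v‖ < ε

end KreinSystem

end

/-!
Let `T_ξ u = ∫_a^ξ K(·, s) u(s) ds` on `C([a, b])`. This operator is compact, so uniqueness makes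
`1 - T_ξ` invertible, and pairing a solution of the adjoint homogeneous equation with test functions
`u - T_ξ u` transfers this to the adjoint equation.

Since `T_ξ` is strongly differentiable in `ξ`, so is `R_ξ = (1 - T_ξ)⁻¹`, and
`∂_ξ (R_ξ f) = Γ_ξ (R_ξ f)(ξ)` where `Γ_ξ = R_ξ K(·, ξ)`; for `f = I` this is
`∂_ξ g(·, ξ) = Γ_ξ g(ξ, ξ)`. As `g*(ξ, ξ) = I + ∫_a^ξ Γ_ξ(t) dt` by duality, integration over
`[a, ξ]` yields `d/dξ ∫_a^ξ R_ξ f = g*(ξ, ξ) (R_ξ f)(ξ)`. Hence `M'(ξ) = g*(ξ, ξ) g(ξ, ξ)` and,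
since `∫_a^ξ g* f = ∫_a^ξ R_ξ f` by duality, `g(ξ, ξ) F(ξ) = (R_ξ f)(ξ)`. Therefore
`∂_ξ (R_ξ f)(t) = ∂_ξ g(t, ξ) F(ξ)`, and integrating this by parts from `ξ = t` to `ξ = b` gives the
formula for `φ = R_b f`.
-/

noncomputable section

namespace KreinSystem

open Filter Topology

/-- A product rule that does not require `A` to be differentiable in operator norm, as
`HasDerivWithinAt.clm_apply` does. -/
theorem hasDerivWithinAt_clm_apply_of_strong {𝕜 V W : Type*} [NontriviallyNormedField 𝕜]
    [NormedAddCommGroup V] [NormedSpace 𝕜 V] [NormedAddCommGroup W] [NormedSpace 𝕜 W]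
    {A : 𝕜 → V →L[𝕜] W} {φ : 𝕜 → V} {φ' : V} {d : W} {S : Set 𝕜} {ξ : 𝕜}
    (hA : ContinuousWithinAt A S ξ) (hφ : HasDerivWithinAt φ φ' S ξ)
    (hd : HasDerivWithinAt (fun η => A η (φ ξ)) d S ξ) :
    HasDerivWithinAt (fun η => A η (φ η)) (A ξ φ' + d) S ξ := by
  rw [hasDerivWithinAt_iff_tendsto_slope] at hφ hd ⊢
  have hslope := (((isBoundedBilinearMap_apply (𝕜 := 𝕜) (E := V) (F := W)).continuous.tendsto
    (A ξ, φ')).comp ((hA.mono (sdiff_subset (t := {ξ}))).tendsto.prodMk_nhds hφ)).add hd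
  refine hslope.congr fun η => ?_
  simp only [Function.comp_apply, slope, vsub_eq_sub, map_smul, map_sub, ← smul_add]
  congr 1
  abel

section CompactOperator

variable {X Y V : Type*} [NormedAddCommGroup X] [NormedSpace ℝ X] [TopologicalSpace Y]
  [CompactSpace Y] [NormedAddCommGroup V] [NormedSpace ℝ V] [ProperSpace V]

theorem isCompactOperator_of_equicontinuous (T : X →L[ℝ] C(Y, V))
    (hT : Equicontinuous fun (u : Metric.ball (0 : X) 1) (y : Y) => T u y) :
    IsCompactOperator T := by
  refine (isCompactOperator_iff_isCompact_closure_image_ball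
    (T : X →ₗ[ℝ] C(Y, V)) zero_lt_one).2 ?_
  let e := ContinuousMap.isometryEquivBoundedOfCompact Y V
  suffices IsCompact (closure (e '' (T '' Metric.ball 0 1))) by
    change IsCompact (closure (T '' Metric.ball 0 1))
    rwa [← e.toHomeomorph.isCompact_image, e.toHomeomorph.image_closure]
  refine BoundedContinuousFunction.arzela_ascoli
    (Metric.closedBall (0 : V) ‖T‖) (isCompact_closedBall _ _) _ ?_ fun y U hU => ?_
  · rintro _ y ⟨_, ⟨u, hu, rfl⟩, rfl⟩
    rw [mem_ball_zero_iff] at hu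
    rw [mem_closedBall_zero_iff]
    exact ((T u).norm_coe_le_norm y).trans
      ((T.le_opNorm u).trans (mul_le_of_le_one_right (norm_nonneg _) hu.le))
  · filter_upwards [hT y U hU] with y' hy'
    rintro ⟨_, _, ⟨u, hu, rfl⟩, rfl⟩
    exact hy' ⟨u, hu⟩

end CompactOperator

section KernelOperator

variable {a b : ℝ} {V : Type*} [NormedAddCommGroup V] [NormedSpace ℝ V]

/-- Pointwise application of a continuous family of operators to a vector. -/
def applyPointwise (X V W : Type*) [TopologicalSpace X] [CompactSpace X] [NormedAddCommGroup V]
    [NormedSpace ℝ V] [NormedAddCommGroup W] [NormedSpace ℝ W] :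
    C(X, V →L[ℝ] W) →L[ℝ] V →L[ℝ] C(X, W) :=
  LinearMap.mkContinuous₂
    (LinearMap.mk₂ ℝ (fun (A : C(X, V →L[ℝ] W)) v => (⟨fun x => A x v, by fun_prop⟩ : C(X, W)))
      (fun _ _ _ => rfl) (fun _ _ _ => rfl) (fun _ _ _ => by ext; simp) fun _ _ _ => by ext; simp)
    1 fun A v => by
      rw [one_mul, ContinuousMap.norm_le _ (by positivity)]
      exact fun x => (A x).le_of_opNorm_le (A.norm_coe_le_norm x) v

/-- The operator `v ↦ k(·, s) v`, with `s` first projected to `[a, b]`. -/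
def kernelColumn (hab : a ≤ b) (k : C(Icc a b × Icc a b, V →L[ℝ] V)) (s : ℝ) :
    V →L[ℝ] C(Icc a b, V) :=
  applyPointwise (Icc a b) V V ((k.comp ContinuousMap.prodSwap).curry (projIcc a b hab s))

variable (hab : a ≤ b) (k : C(Icc a b × Icc a b, V →L[ℝ] V))

theorem kernelColumn_apply (s : ℝ) (v : V) (t : Icc a b) :
    kernelColumn hab k s v t = k (t, projIcc a b hab s) v := rfl

theorem continuous_kernelColumn : Continuous (kernelColumn hab k) :=
  (applyPointwise (Icc a b) V V).continuous.comp
    ((ContinuousMap.continuous _).comp continuous_projIcc)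

theorem norm_kernelColumn_apply_le (s : ℝ) (v : V) : ‖kernelColumn hab k s v‖ ≤ ‖k‖ * ‖v‖ := by
  rw [ContinuousMap.norm_le _ (by positivity)]
  exact fun t => (k _).le_of_opNorm_le (k.norm_coe_le_norm _) v

theorem continuous_kernelColumn_apply (u : C(Icc a b, V)) :
    Continuous fun s => kernelColumn hab k s (u (projIcc a b hab s)) :=
  (continuous_kernelColumn hab k).clm_apply (u.continuous.comp continuous_projIcc)

theorem norm_integral_kernelColumn_apply_le (ξ η : ℝ) (u : C(Icc a b, V)) :
    ‖∫ s in ξ..η, kernelColumn hab k s (u (projIcc a b hab s))‖ ≤ ‖k‖ * |η - ξ| * ‖u‖ := by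
  refine (intervalIntegral.norm_integral_le_of_norm_le_const fun s _ =>
    (norm_kernelColumn_apply_le hab k s _).trans
      (mul_le_mul_of_nonneg_left (u.norm_coe_le_norm _) (norm_nonneg k))).trans_eq ?_
  ring

/-- The integral operator `u ↦ ∫_a^ξ k(·, s) u(s) ds`. It acts on `C([a, b], V)` for every `ξ`,
so that operators for different `ξ` can be compared. -/
def truncOp (ξ : ℝ) : C(Icc a b, V) →L[ℝ] C(Icc a b, V) :=
  LinearMap.mkContinuous
    { toFun := fun u => ∫ s in a..ξ, kernelColumn hab k s (u (projIcc a b hab s))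
      map_add' := fun u v => by
        simp only [ContinuousMap.add_apply, map_add]
        exact intervalIntegral.integral_add
          ((continuous_kernelColumn_apply hab k u).intervalIntegrable _ _)
          ((continuous_kernelColumn_apply hab k v).intervalIntegrable _ _)
      map_smul' := fun c u => by
        simp only [ContinuousMap.smul_apply, map_smul, RingHom.id_apply]
        exact intervalIntegral.integral_smul c _ }
    (‖k‖ * |ξ - a|) (norm_integral_kernelColumn_apply_le hab k a ξ)

theorem truncOp_eq_integral (ξ : ℝ) (u : C(Icc a b, V)) :
    truncOp hab k ξ u = ∫ s in a..ξ, kernelColumn hab k s (u (projIcc a b hab s)) := rfl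

theorem norm_truncOp_sub_le (ξ η : ℝ) :
    ‖truncOp hab k ξ - truncOp hab k η‖ ≤ ‖k‖ * |ξ - η| := by
  refine ContinuousLinearMap.opNorm_le_bound _ (by positivity) fun u => ?_
  rw [_root_.sub_apply, truncOp_eq_integral, truncOp_eq_integral,
    intervalIntegral.integral_interval_sub_left
      ((continuous_kernelColumn_apply hab k u).intervalIntegrable _ _)
      ((continuous_kernelColumn_apply hab k u).intervalIntegrable _ _)]
  exact norm_integral_kernelColumn_apply_le hab k η ξ u

theorem continuous_truncOp : Continuous (truncOp hab k) := by
  refine (LipschitzWith.of_dist_le_mul (f := truncOp hab k) (K := ‖k‖₊) fun ξ η => ?_).continuous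
  rw [dist_eq_norm (truncOp hab k ξ), Real.dist_eq, coe_nnnorm]
  exact norm_truncOp_sub_le hab k ξ η

section Complete

variable [CompleteSpace V]

theorem truncOp_apply (ξ : ℝ) (u : C(Icc a b, V)) (t : Icc a b) :
    truncOp hab k ξ u t = ∫ s in a..ξ, k (t, projIcc a b hab s) (u (projIcc a b hab s)) :=
  ((ContinuousMap.evalCLM (M := V) ℝ t).intervalIntegral_comp_comm
    ((continuous_kernelColumn_apply hab k u).intervalIntegrable (μ := volume) a ξ)).symm

theorem hasDerivAt_truncOp_apply (u : C(Icc a b, V)) (ξ : ℝ) :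
    HasDerivAt (fun η => truncOp hab k η u) (kernelColumn hab k ξ (u (projIcc a b hab ξ))) ξ :=
  (continuous_kernelColumn_apply hab k u).integral_hasStrictDerivAt a ξ |>.hasDerivAt

theorem dist_truncOp_apply_le (ξ : ℝ) (u : C(Icc a b, V)) (t t' : Icc a b) :
    dist (truncOp hab k ξ u t) (truncOp hab k ξ u t') ≤
      dist (k.curry t) (k.curry t') * ‖u‖ * |ξ - a| := by
  have hc (t : Icc a b) : Continuous fun s : ℝ =>
      k (t, projIcc a b hab s) (u (projIcc a b hab s)) :=
    (continuous_eval_const t).comp (continuous_kernelColumn_apply hab k u)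
  rw [dist_eq_norm, truncOp_apply, truncOp_apply, ← intervalIntegral.integral_sub
    ((hc t).intervalIntegrable _ _) ((hc t').intervalIntegrable _ _)]
  refine intervalIntegral.norm_integral_le_of_norm_le_const fun s _ => ?_
  rw [← _root_.sub_apply, dist_eq_norm (k.curry t)]
  exact ContinuousLinearMap.le_of_opNorm_le_of_le _
    ((k.curry t - k.curry t').norm_coe_le_norm (projIcc a b hab s)) (u.norm_coe_le_norm _)

theorem equicontinuous_truncOp_ball (ξ : ℝ) :
    Equicontinuous fun (u : Metric.ball (0 : C(Icc a b, V)) 1) (t : Icc a b) =>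
      truncOp hab k ξ u t := by
  intro t
  refine Metric.equicontinuousAt_of_continuity_modulus
    (fun t' => dist (k.curry t) (k.curry t') * 1 * |ξ - a|) ?_ _ (Eventually.of_forall ?_)
  · have hmod : Continuous fun t' => dist (k.curry t) (k.curry t') * 1 * |ξ - a| := by
      have := k.curry.continuous
      fun_prop
    simpa only [dist_self, zero_mul] using hmod.tendsto t
  · rintro t' ⟨u, hu⟩
    rw [mem_ball_zero_iff] at hu
    refine (dist_truncOp_apply_le hab k ξ u t t').trans ?_
    gcongr

end Complete

variable {hab k}

/-- Beyond `ξ`, a fixed point is determined by its values on `(a, ξ]`, so it suffices to show that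
it vanishes there. -/
theorem isUnit_one_sub_truncOp [FiniteDimensional ℝ V] {ξ : ℝ} (hξ : a ≤ ξ)
    (h : ∀ u, truncOp hab k ξ u = u → ∀ s ∈ Ioc a ξ, u (projIcc a b hab s) = 0) :
    IsUnit (1 - truncOp hab k ξ) := by
  have := FiniteDimensional.proper ℝ V
  have hcompact := isCompactOperator_of_equicontinuous _ (equicontinuous_truncOp_ball hab k ξ)
  rcases hcompact.hasEigenvalue_or_mem_resolventSet (one_ne_zero (α := ℝ)) with heig | hres
  · obtain ⟨u, hu⟩ := heig.exists_hasEigenvector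
    have hfix : truncOp hab k ξ u = u := by simpa using hu.apply_eq_smul
    refine absurd ?_ hu.2
    rw [← hfix, truncOp_eq_integral]
    refine intervalIntegral.integral_zero_ae (Eventually.of_forall fun s hs => ?_)
    rw [uIoc_of_le hξ] at hs
    rw [h u hfix s hs, map_zero]
  · simpa [spectrum.mem_resolventSet_iff] using hres

variable (hab k)

/-- The resolvent `(1 - T_ξ)⁻¹` of the truncated integral operator; it is `0` when `1 - T_ξ` is not
invertible. -/
def truncRes (ξ : ℝ) : C(Icc a b, V) →L[ℝ] C(Icc a b, V) := Ring.inverse (1 - truncOp hab k ξ)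

variable {hab k}

theorem truncRes_sub_truncOp {ξ : ℝ} (h : IsUnit (1 - truncOp hab k ξ)) (u : C(Icc a b, V)) :
    truncRes hab k ξ (u - truncOp hab k ξ u) = u :=
  congrArg (fun A : C(Icc a b, V) →L[ℝ] C(Icc a b, V) => A u) (Ring.inverse_mul_cancel _ h)

theorem truncRes_sub_truncOp_truncRes {ξ : ℝ} (h : IsUnit (1 - truncOp hab k ξ))
    (f : C(Icc a b, V)) :
    truncRes hab k ξ f - truncOp hab k ξ (truncRes hab k ξ f) = f :=
  congrArg (fun A : C(Icc a b, V) →L[ℝ] C(Icc a b, V) => A f) (Ring.mul_inverse_cancel _ h)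

/-- Every truncated equation with kernel `k` is uniquely solvable. -/
def IsRegular (hab : a ≤ b) (k : C(Icc a b × Icc a b, V →L[ℝ] V)) : Prop :=
  ∀ ξ ∈ Icc a b, IsUnit (1 - truncOp hab k ξ)

variable (hab k) in
/-- The operator `v ↦ (1 - T_ξ)⁻¹ (k(·, ξ) v)`, i.e. `v ↦ Γ_ξ(·, ξ) v` for the resolvent kernel
`Γ_ξ` of the equation truncated at `ξ`. -/
def resolventColumn (ξ : ℝ) : V →L[ℝ] C(Icc a b, V) :=
  truncRes hab k ξ ∘L kernelColumn hab k ξ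

section Regular

variable [CompleteSpace V] (hk : IsRegular hab k)
include hk

theorem continuousOn_truncRes : ContinuousOn (truncRes hab k) (Icc a b) := by
  intro ξ hξ
  obtain ⟨x, hx⟩ := hk ξ hξ
  have hinv : ContinuousAt Ring.inverse (1 - truncOp hab k ξ) :=
    hx ▸ NormedRing.inverse_continuousAt (R := C(Icc a b, V) →L[ℝ] C(Icc a b, V)) x
  exact (ContinuousAt.comp (f := fun η => 1 - truncOp hab k η) hinv
    (continuous_const.sub (continuous_truncOp hab k)).continuousAt).continuousWithinAt

theorem continuousOn_resolventColumn : ContinuousOn (resolventColumn hab k) (Icc a b) :=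
  (continuousOn_truncRes hk).clm_comp (continuous_kernelColumn hab k).continuousOn

theorem continuousOn_truncRes_apply_diag (f : C(Icc a b, V)) :
    ContinuousOn (fun ξ => truncRes hab k ξ f (projIcc a b hab ξ)) (Icc a b) :=
  continuous_eval.comp_continuousOn
    (((continuousOn_truncRes hk).clm_apply continuousOn_const).prodMk
      (continuous_projIcc (h := hab)).continuousOn)

theorem hasDerivWithinAt_truncRes_apply (f : C(Icc a b, V)) {ξ : ℝ} (hξ : ξ ∈ Icc a b) :
    HasDerivWithinAt (fun η => truncRes hab k η f)
      (resolventColumn hab k ξ (truncRes hab k ξ f (projIcc a b hab ξ))) (Icc a b) ξ := by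
  set u := truncRes hab k ξ f
  have hT : HasDerivWithinAt (fun η => truncOp hab k η u - truncOp hab k ξ u)
      (kernelColumn hab k ξ (u (projIcc a b hab ξ))) (Icc a b) ξ :=
    ((hasDerivAt_truncOp_apply hab k u ξ).sub_const _).hasDerivWithinAt
  have hRT := hasDerivWithinAt_clm_apply_of_strong (continuousOn_truncRes hk ξ hξ) hT (d := 0)
    (by simpa using hasDerivWithinAt_const ξ (Icc a b) (0 : C(Icc a b, V)))
  rw [add_zero] at hRT
  refine (hRT.add_const u).congr_of_mem (fun η hη => ?_) hξ
  calc truncRes hab k η f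
      = truncRes hab k η ((u - truncOp hab k η u) + (truncOp hab k η u - truncOp hab k ξ u)) := by
        rw [sub_add_sub_cancel, truncRes_sub_truncOp_truncRes (hk ξ hξ)]
    _ = truncRes hab k η (truncOp hab k η u - truncOp hab k ξ u) + u := by
        rw [map_add, truncRes_sub_truncOp (hk η hη), add_comm]

theorem hasDerivWithinAt_truncRes_apply_apply (f : C(Icc a b, V)) (t : Icc a b) {ξ : ℝ}
    (hξ : ξ ∈ Icc a b) :
    HasDerivWithinAt (fun η => truncRes hab k η f t)
      (resolventColumn hab k ξ (truncRes hab k ξ f (projIcc a b hab ξ)) t) (Icc a b) ξ :=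
  (ContinuousMap.evalCLM (M := V) ℝ t).hasFDerivAt.comp_hasDerivWithinAt ξ
    (hasDerivWithinAt_truncRes_apply hk f hξ)

theorem continuousOn_resolventColumn_truncRes_diag (f : C(Icc a b, V)) (t : Icc a b) :
    ContinuousOn (fun ξ => resolventColumn hab k ξ
      (truncRes hab k ξ f (projIcc a b hab ξ)) t) (Icc a b) :=
  (continuous_eval_const t).comp_continuousOn
    ((continuousOn_resolventColumn hk).clm_apply (continuousOn_truncRes_apply_diag hk f))

end Regular

end KernelOperator

theorem hasDerivWithinAt_integral_projIcc {a b : ℝ} (hab : a ≤ b) {V : Type*}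
    [NormedAddCommGroup V] [NormedSpace ℝ V] [CompleteSpace V] {φ : ℝ → C(Icc a b, V)}
    {φ' : C(Icc a b, V)} {S : Set ℝ} {ξ : ℝ} (hφ : HasDerivWithinAt φ φ' S ξ) :
    HasDerivWithinAt (fun η => ∫ t in a..η, φ η (projIcc a b hab t))
      ((∫ t in a..ξ, φ' (projIcc a b hab t)) + φ ξ (projIcc a b hab ξ)) S ξ := by
  -- The integral is `truncOp` for the constant kernel `id`, evaluated at any point.
  let k : C(Icc a b × Icc a b, V →L[ℝ] V) := ContinuousMap.const _ (ContinuousLinearMap.id ℝ V)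
  let t₀ := projIcc a b hab a
  have hT := hasDerivWithinAt_clm_apply_of_strong
    (continuous_truncOp hab k).continuousWithinAt hφ
    (hasDerivAt_truncOp_apply hab k (φ ξ) ξ).hasDerivWithinAt
  have heval := (ContinuousMap.evalCLM (M := V) ℝ t₀).hasFDerivAt.comp_hasDerivWithinAt ξ hT
  have hk (η : ℝ) (u : C(Icc a b, V)) :
      ContinuousMap.evalCLM (M := V) ℝ t₀ (truncOp hab k η u) =
        ∫ t in a..η, u (projIcc a b hab t) := truncOp_apply hab k η u t₀
  simp only [map_add, hk, Function.comp_def] at heval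
  exact heval

theorem intervalIntegral_swap_of_continuous {W : Type*} [NormedAddCommGroup W] [NormedSpace ℝ W]
    {a b c d : ℝ} {f : ℝ → ℝ → W} (hf : Continuous (Function.uncurry f)) :
    ∫ x in a..b, ∫ y in c..d, f x y = ∫ y in c..d, ∫ x in a..b, f x y := by
  refine intervalIntegral_intervalIntegral_swap ?_
  exact (hf.continuousOn.integrableOn_compact (isCompact_uIcc.prod isCompact_uIcc)).mono_set
    (prod_mono uIoc_subset_uIcc uIoc_subset_uIcc)

section Duality

variable {a b : ℝ} {V E W : Type*} [NormedAddCommGroup V] [NormedSpace ℝ V]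
  [NormedAddCommGroup E] [NormedSpace ℝ E] [NormedAddCommGroup W] [NormedSpace ℝ W]

/-- The kernel `k'` is the transpose of the kernel `k` with respect to the pairing `B`. -/
def IsAdjointKernel (B : V →L[ℝ] E →L[ℝ] W) (k' : C(Icc a b × Icc a b, V →L[ℝ] V))
    (k : C(Icc a b × Icc a b, E →L[ℝ] E)) : Prop :=
  ∀ s t x v, B (k' (t, s) x) v = B x (k (s, t) v)

variable {hab : a ≤ b} {B : V →L[ℝ] E →L[ℝ] W} {k' : C(Icc a b × Icc a b, V →L[ℝ] V)}
  {k : C(Icc a b × Icc a b, E →L[ℝ] E)}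

section Pairing

variable [CompleteSpace V] [CompleteSpace E] [CompleteSpace W] (hB : IsAdjointKernel B k' k)
include hB

theorem integral_pairing_truncOp (ξ : ℝ) (p : C(Icc a b, V)) (u : C(Icc a b, E)) :
    ∫ t in a..ξ, B (p (projIcc a b hab t)) (truncOp hab k ξ u (projIcc a b hab t)) =
      ∫ s in a..ξ, B (truncOp hab k' ξ p (projIcc a b hab s)) (u (projIcc a b hab s)) := by
  have : Continuous (projIcc a b hab) := continuous_projIcc
  calc _ = ∫ t in a..ξ, ∫ s in a..ξ, B (p (projIcc a b hab t))
          (k (projIcc a b hab t, projIcc a b hab s) (u (projIcc a b hab s))) := by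
        refine intervalIntegral.integral_congr fun t _ => ?_
        simp only [truncOp_apply]
        exact ((B (p (projIcc a b hab t))).intervalIntegral_comp_comm
          (Continuous.intervalIntegrable (by fun_prop) _ _)).symm
    _ = ∫ s in a..ξ, ∫ t in a..ξ, B (p (projIcc a b hab t))
          (k (projIcc a b hab t, projIcc a b hab s) (u (projIcc a b hab s))) :=
        intervalIntegral_swap_of_continuous (by unfold Function.uncurry; fun_prop)
    _ = _ := by
        refine intervalIntegral.integral_congr fun s _ => ?_
        simp only [truncOp_apply, ← hB _ _ _ _]
        exact (B.flip (u (projIcc a b hab s))).intervalIntegral_comp_comm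
          (Continuous.intervalIntegrable (by fun_prop) _ _)

theorem integral_pairing_eq {ξ : ℝ} {p q : C(Icc a b, V)} {u f : C(Icc a b, E)}
    (hp : p - truncOp hab k' ξ p = q) (hu : u - truncOp hab k ξ u = f) :
    ∫ t in a..ξ, B (p (projIcc a b hab t)) (f (projIcc a b hab t)) =
      ∫ t in a..ξ, B (q (projIcc a b hab t)) (u (projIcc a b hab t)) := by
  have : Continuous (projIcc a b hab) := continuous_projIcc
  have hpair := integral_pairing_truncOp (hab := hab) hB ξ p u
  subst hp hu
  simp only [ContinuousMap.sub_apply, map_sub, _root_.sub_apply]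
  rw [intervalIntegral.integral_sub, intervalIntegral.integral_sub, hpair] <;>
  exact Continuous.intervalIntegrable (by fun_prop) _ _

end Pairing

theorem isUnit_one_sub_truncOp_adjoint [FiniteDimensional ℝ V] [CompleteSpace E] [CompleteSpace W]
    (hB : IsAdjointKernel B k' k) (hsep : ∀ x, (∀ v, B x v = 0) → x = 0) {ξ : ℝ} (hξ : a ≤ ξ)
    (h : IsUnit (1 - truncOp hab k ξ)) : IsUnit (1 - truncOp hab k' ξ) := by
  have := FiniteDimensional.complete ℝ V
  have : Continuous (projIcc a b hab) := continuous_projIcc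
  refine isUnit_one_sub_truncOp hξ fun p hp s hs => hsep _ fun v => ?_
  refine (SeparatingDual.eq_iff_forall_dual_eq (R := ℝ)).2 fun ℓ => ?_
  rw [map_zero]
  -- Pairing `p` with the test function `ℓ(B(p, v)) v` yields the integral of a square.
  let f : C(Icc a b, E) := ⟨fun t => ℓ (B (p t) v) • v, by fun_prop⟩
  have hzero := congrArg ℓ (integral_pairing_eq hB (sub_eq_zero.2 hp.symm)
    (truncRes_sub_truncOp_truncRes h f))
  rw [← ℓ.intervalIntegral_comp_comm (Continuous.intervalIntegrable (by fun_prop) _ _)] at hzero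
  simp only [f, ContinuousMap.coe_mk, map_smul, ContinuousMap.zero_apply, map_zero,
    _root_.zero_apply, intervalIntegral.integral_zero, smul_eq_mul] at hzero
  by_contra hne
  exact (intervalIntegral.integral_pos (hs.1.trans_le hs.2) (Continuous.continuousOn (by fun_prop))
    (fun t _ => mul_self_nonneg (ℓ (B (p (projIcc a b hab t)) v)))
    ⟨s, Ioc_subset_Icc_self hs, mul_self_pos.2 hne⟩).ne' hzero

section Unit

variable {B : V →L[ℝ] E →L[ℝ] E} [CompleteSpace V] [CompleteSpace E]
  (hB : IsAdjointKernel B k' k) {e : V} (he : ∀ v, B e v = v)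
include hB he

theorem integral_pairing_truncRes_const {ξ : ℝ} (h' : IsUnit (1 - truncOp hab k' ξ))
    (h : IsUnit (1 - truncOp hab k ξ)) (f : C(Icc a b, E)) :
    ∫ t in a..ξ, B (truncRes hab k' ξ (.const _ e) (projIcc a b hab t)) (f (projIcc a b hab t)) =
      ∫ t in a..ξ, truncRes hab k ξ f (projIcc a b hab t) := by
  simpa only [ContinuousMap.const_apply, he] using integral_pairing_eq hB
    (truncRes_sub_truncOp_truncRes h' (.const _ e)) (truncRes_sub_truncOp_truncRes h f)

theorem pairing_truncRes_const_diag {ξ : ℝ} (h' : IsUnit (1 - truncOp hab k' ξ))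
    (h : IsUnit (1 - truncOp hab k ξ)) (v : E) :
    B (truncRes hab k' ξ (.const _ e) (projIcc a b hab ξ)) v =
      (∫ t in a..ξ, resolventColumn hab k ξ v (projIcc a b hab t)) + v := by
  have : Continuous (projIcc a b hab) := continuous_projIcc
  have hdiag := congrArg (fun x : C(Icc a b, V) => B (x (projIcc a b hab ξ)) v)
    (truncRes_sub_truncOp_truncRes h' (.const _ e))
  simp only [ContinuousMap.sub_apply, ContinuousMap.const_apply, map_sub, _root_.sub_apply, he,
    sub_eq_iff_eq_add'] at hdiag
  rw [hdiag]
  congr 1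
  rw [truncOp_apply]
  refine Eq.trans ?_ (integral_pairing_truncRes_const hB he h' h (kernelColumn hab k ξ v))
  simp only [kernelColumn_apply, ← hB _ _ _ _]
  exact ((B.flip v).intervalIntegral_comp_comm
    (Continuous.intervalIntegrable (by fun_prop) _ _)).symm

theorem hasDerivWithinAt_integral_truncRes (hk' : IsRegular hab k') (hk : IsRegular hab k)
    (f : C(Icc a b, E)) {ξ : ℝ} (hξ : ξ ∈ Icc a b) :
    HasDerivWithinAt (fun η => ∫ t in a..η, truncRes hab k η f (projIcc a b hab t))
      (B (truncRes hab k' ξ (.const _ e) (projIcc a b hab ξ))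
        (truncRes hab k ξ f (projIcc a b hab ξ))) (Icc a b) ξ := by
  rw [pairing_truncRes_const_diag hB he (hk' ξ hξ) (hk ξ hξ)]
  exact hasDerivWithinAt_integral_projIcc hab (hasDerivWithinAt_truncRes_apply hk f hξ)

end Unit

end Duality

section IntegralEquation

variable {a b : ℝ} {V : Type*} [NormedAddCommGroup V] [NormedSpace ℝ V]

/-- `h` is a continuous solution on `[a, ξ]` of `h(t) - ∫_a^ξ κ(t, s) h(s) ds = q(t)`. -/
def IsIntegralSol (κ : ℝ → ℝ → V →L[ℝ] V) (a ξ : ℝ) (q h : ℝ → V) : Prop :=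
  ContinuousOn h (Icc a ξ) ∧ ∀ t ∈ Icc a ξ, h t - ∫ s in a..ξ, κ t s (h s) = q t

variable {hab : a ≤ b} {k : C(Icc a b × Icc a b, V →L[ℝ] V)} {κ : ℝ → ℝ → V →L[ℝ] V} {ξ : ℝ}
  {q h : ℝ → V} (hκ : ∀ t s : Icc a b, k (t, s) = κ t s) (hξ : ξ ∈ Icc a b)
include hκ hξ

theorem continuousOn_kernel_apply (hh : ContinuousOn h (Icc a ξ)) (t : Icc a b) :
    ContinuousOn (fun s => κ t s (h s)) (Icc a ξ) := by
  have hab : a ≤ b := hξ.1.trans hξ.2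
  have hkt : Continuous fun s : ℝ => k (t, projIcc a b hab s) :=
    k.continuous.comp (continuous_const.prodMk continuous_projIcc)
  refine (hkt.continuousOn.clm_apply hh).congr fun s hs => ?_
  simp only [hκ, projIcc_of_mem hab ⟨hs.1, hs.2.trans hξ.2⟩]

theorem IsIntegralSol.add {q' h' : ℝ → V} (hh : IsIntegralSol κ a ξ q h)
    (hh' : IsIntegralSol κ a ξ q' h') : IsIntegralSol κ a ξ (q + q') (h + h') := by
  refine ⟨hh.1.add hh'.1, fun t ht => ?_⟩
  have ht' : t ∈ Icc a b := ⟨ht.1, ht.2.trans hξ.2⟩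
  simp only [Pi.add_apply, map_add]
  rw [intervalIntegral.integral_add
    ((continuousOn_kernel_apply hκ hξ hh.1 ⟨t, ht'⟩).intervalIntegrable_of_Icc hξ.1)
    ((continuousOn_kernel_apply hκ hξ hh'.1 ⟨t, ht'⟩).intervalIntegrable_of_Icc hξ.1),
    ← hh.2 t ht, ← hh'.2 t ht]
  abel

variable [CompleteSpace V]

theorem truncOp_apply_eq_integral {u : C(Icc a b, V)}
    (hu : ∀ s ∈ Icc a ξ, u (projIcc a b hab s) = h s) (t : Icc a b) :
    truncOp hab k ξ u t = ∫ s in a..ξ, κ t s (h s) := by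
  rw [truncOp_apply]
  refine intervalIntegral.integral_congr fun s hs => ?_
  rw [uIcc_of_le hξ.1] at hs
  simp only [← hu s hs, hκ, projIcc_of_mem hab ⟨hs.1, hs.2.trans hξ.2⟩]

variable {u f : C(Icc a b, V)} (hq : ∀ t : Icc a b, f t = q t)
include hq

theorem isIntegralSol_of_sub_truncOp_eq (hu : u - truncOp hab k ξ u = f) :
    IsIntegralSol κ a ξ q fun t => u (projIcc a b hab t) := by
  refine ⟨(u.continuous.comp continuous_projIcc).continuousOn, fun t ht => ?_⟩
  have ht' : t ∈ Icc a b := ⟨ht.1, ht.2.trans hξ.2⟩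
  have hT := truncOp_apply_eq_integral (hab := hab) hκ hξ (u := u) (fun _ _ => rfl) ⟨t, ht'⟩
  simp only [← hT, projIcc_of_mem hab ht', ← hq ⟨t, ht'⟩, ← hu, ContinuousMap.sub_apply]

theorem isIntegralSol_truncRes (hu : IsUnit (1 - truncOp hab k ξ)) :
    IsIntegralSol κ a ξ q fun t => truncRes hab k ξ f (projIcc a b hab t) :=
  isIntegralSol_of_sub_truncOp_eq hκ hξ hq (truncRes_sub_truncOp_truncRes hu f)

theorem IsIntegralSol.eq_truncRes (hu : IsUnit (1 - truncOp hab k ξ))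
    (hh : IsIntegralSol κ a ξ q h) {t : ℝ} (ht : t ∈ Icc a ξ) :
    h t = truncRes hab k ξ f (projIcc a b hab t) := by
  -- `f + T_ξ h` extends `h` from `[a, ξ]` to a solution on `[a, b]`.
  let h' : C(Icc a b, V) := ⟨fun s => h (projIcc a ξ hξ.1 s),
    (hh.1.comp_continuous (by fun_prop) fun s => (projIcc a ξ hξ.1 s).2)⟩
  have hh' : ∀ s ∈ Icc a ξ, h' (projIcc a b hab s) = h s := fun s hs => by
    simp only [h', ContinuousMap.coe_mk, projIcc_of_mem hab ⟨hs.1, hs.2.trans hξ.2⟩,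
      projIcc_of_mem hξ.1 hs]
  set w := f + truncOp hab k ξ h' with hw
  have hwh : ∀ s ∈ Icc a ξ, w (projIcc a b hab s) = h s := fun s hs => by
    rw [hw, ContinuousMap.add_apply, truncOp_apply_eq_integral hκ hξ hh', hq,
      projIcc_of_mem hab ⟨hs.1, hs.2.trans hξ.2⟩, ← hh.2 s hs, sub_add_cancel]
  have hTw : truncOp hab k ξ w = truncOp hab k ξ h' := by
    ext1 s
    rw [truncOp_apply_eq_integral hκ hξ hwh, truncOp_apply_eq_integral hκ hξ hh']
  rw [← hwh t ht, ← truncRes_sub_truncOp hu w, hTw, hw, add_sub_cancel_right]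

omit [CompleteSpace V] hq in
theorem isUnit_one_sub_truncOp_of_unique [FiniteDimensional ℝ V] (hh : IsIntegralSol κ a ξ q h)
    (huniq : ∀ h', IsIntegralSol κ a ξ q h' → EqOn h' h (Ioc a ξ)) :
    IsUnit (1 - truncOp hab k ξ) := by
  have := FiniteDimensional.complete ℝ V
  refine isUnit_one_sub_truncOp hξ.1 fun u hu s hs => ?_
  have hzero : IsIntegralSol κ a ξ 0 fun t => u (projIcc a b hab t) :=
    isIntegralSol_of_sub_truncOp_eq hκ hξ (f := 0) (fun _ => rfl) (sub_eq_zero.2 hu.symm)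
  have hadd := hh.add hκ hξ hzero
  rw [add_zero] at hadd
  simpa using huniq _ hadd hs

end IntegralEquation

theorem integral_eq_sub_of_hasDerivWithinAt_Icc {W : Type*} [NormedAddCommGroup W]
    [NormedSpace ℝ W] [CompleteSpace W] {c d x y : ℝ} {f f' : ℝ → W}
    (hf : ∀ s ∈ Icc c d, HasDerivWithinAt f (f' s) (Icc c d) s) (hf' : ContinuousOn f' (Icc c d))
    (hx : c ≤ x) (hxy : x ≤ y) (hy : y ≤ d) : ∫ s in x..y, f' s = f y - f x := by
  have hsub : Icc x y ⊆ Icc c d := Icc_subset_Icc hx hy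
  refine intervalIntegral.integral_eq_sub_of_hasDerivAt_of_le hxy
    (fun s hs => (hf s (hsub hs)).continuousWithinAt.mono hsub) (fun s hs => ?_)
    ((hf'.mono hsub).intervalIntegrable_of_Icc hxy)
  exact (hf s (hsub (Ioo_subset_Icc_self hs))).hasDerivAt
    (Icc_mem_nhds (hx.trans_lt hs.1) (hs.2.trans_le hy))

section Intertwining

variable {a b : ℝ} {hab : a ≤ b} {V E : Type*} [NormedAddCommGroup V] [NormedSpace ℝ V]
  [CompleteSpace V] [NormedAddCommGroup E] [NormedSpace ℝ E] [CompleteSpace E]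
  {kV : C(Icc a b × Icc a b, V →L[ℝ] V)} {kE : C(Icc a b × Icc a b, E →L[ℝ] E)}

section Map

variable {L : V →L[ℝ] E} (hL : ∀ p x, L (kV p x) = kE p (L x)) {ξ : ℝ}
include hL

theorem map_truncOp (u : C(Icc a b, V)) :
    L.compLeftContinuous ℝ _ (truncOp hab kV ξ u) =
      truncOp hab kE ξ (L.compLeftContinuous ℝ _ u) := by
  ext1 t
  have hcont : Continuous fun s : ℝ => kV (t, projIcc a b hab s) (u (projIcc a b hab s)) :=
    (continuous_eval_const t).comp (continuous_kernelColumn_apply hab kV u)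
  change L (truncOp hab kV ξ u t) = _
  rw [truncOp_apply, truncOp_apply, ← L.intervalIntegral_comp_comm (hcont.intervalIntegrable _ _)]
  exact intervalIntegral.integral_congr fun s _ => hL _ _

theorem map_truncRes (hV : IsUnit (1 - truncOp hab kV ξ)) (hE : IsUnit (1 - truncOp hab kE ξ))
    (f : C(Icc a b, V)) :
    L.compLeftContinuous ℝ _ (truncRes hab kV ξ f) =
      truncRes hab kE ξ (L.compLeftContinuous ℝ _ f) := by
  conv_rhs => rw [← truncRes_sub_truncOp_truncRes hV f, map_sub, map_truncOp hL]
  exact (truncRes_sub_truncOp hE _).symm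

theorem map_resolventColumn (hV : IsUnit (1 - truncOp hab kV ξ))
    (hE : IsUnit (1 - truncOp hab kE ξ)) (x : V) (t : Icc a b) :
    L (resolventColumn hab kV ξ x t) = resolventColumn hab kE ξ (L x) t := by
  have hcol : L.compLeftContinuous ℝ _ (kernelColumn hab kV ξ x) = kernelColumn hab kE ξ (L x) :=
    ContinuousMap.ext fun _ => hL _ x
  have hres := map_truncRes hL hV hE (kernelColumn hab kV ξ x)
  rw [hcol] at hres
  exact DFunLike.congr_fun hres t

end Map

/-- Krein's formula before integration by parts. For `X(ξ)` the diagonal value of `(1 - T_ξ)⁻¹ q`,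
the integrand is the `ξ`-derivative of `(1 - T_ξ)⁻¹ q`, applied to `F(ξ)`. -/
theorem truncRes_sub_truncRes_eq_integral (hV : IsRegular hab kV) (hE : IsRegular hab kE)
    {B : V →L[ℝ] E →L[ℝ] E} (hB : ∀ p x v, B (kV p x) v = kE p (B x v)) {X : ℝ → V}
    {f : C(Icc a b, E)} {F : ℝ → E}
    (hF : ∀ ξ ∈ Icc a b, B (X ξ) (F ξ) = truncRes hab kE ξ f (projIcc a b hab ξ))
    (t : Icc a b) :
    truncRes hab kE b f t - truncRes hab kE t f t =
      ∫ ξ in (t : ℝ)..b, B (resolventColumn hab kV ξ (X ξ) t) (F ξ) := by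
  rw [← integral_eq_sub_of_hasDerivWithinAt_Icc
    (fun ξ hξ => hasDerivWithinAt_truncRes_apply_apply hE f t hξ)
    (continuousOn_resolventColumn_truncRes_diag hE f t) t.2.1 t.2.2 le_rfl]
  refine intervalIntegral.integral_congr fun ξ hξ => ?_
  rw [uIcc_of_le t.2.2] at hξ
  have hξ' : ξ ∈ Icc a b := ⟨t.2.1.trans hξ.1, hξ.2⟩
  have hmap := map_resolventColumn (L := B.flip (F ξ)) (fun p x => hB p x (F ξ)) (hV ξ hξ')
    (hE ξ hξ') (X ξ) t
  simp only [ContinuousLinearMap.flip_apply, hF ξ hξ'] at hmap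
  exact hmap.symm

end Intertwining

section Stieltjes

variable {V W : Type*} [NormedAddCommGroup V] [NormedSpace ℝ V] [NormedAddCommGroup W]
  [NormedSpace ℝ W] [CompleteSpace W] {A A' : ℝ → V →L[ℝ] W} {F : ℝ → V} {c d : ℝ}
  (hA : ∀ s ∈ Icc c d, HasDerivWithinAt A (A' s) (Icc c d) s) (hA' : ContinuousOn A' (Icc c d))
  (hF : ContinuousOn F (Icc c d)) {C ε : ℝ}

section Increment

variable (hC : ∀ s ∈ Icc c d, ‖A' s‖ ≤ C)
include hA hA' hF hC

theorem norm_apply_sub_apply_sub_integral_le {x y : ℝ} (hx : c ≤ x) (hxy : x ≤ y) (hy : y ≤ d)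
    {v : V} (hv : ∀ s ∈ Icc x y, ‖F s - v‖ ≤ ε) :
    ‖(A y v - A x v) - ∫ s in x..y, A' s (F s)‖ ≤ C * ε * (y - x) := by
  have hsub : Icc x y ⊆ Icc c d := Icc_subset_Icc hx hy
  have hAv : ∀ s ∈ Icc c d, HasDerivWithinAt (fun s => A s v) (A' s v) (Icc c d) s :=
    fun s hs => by simpa using (hA s hs).clm_apply (hasDerivWithinAt_const s (Icc c d) v)
  have hAv' : ContinuousOn (fun s => A' s v) (Icc c d) := hA'.clm_apply continuousOn_const
  rw [← integral_eq_sub_of_hasDerivWithinAt_Icc hAv hAv' hx hxy hy,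
    ← intervalIntegral.integral_sub ((hAv'.mono hsub).intervalIntegrable_of_Icc hxy)
      (((hA'.clm_apply hF).mono hsub).intervalIntegrable_of_Icc hxy),
    ← abs_of_nonneg (sub_nonneg.2 hxy)]
  refine intervalIntegral.norm_integral_le_of_norm_le_const fun s hs => ?_
  rw [uIoc_of_le hxy] at hs
  have hs' := Ioc_subset_Icc_self hs
  rw [← map_sub]
  refine (A' s).le_of_opNorm_le_of_le (hC s (hsub hs')) ?_
  rw [norm_sub_rev]
  exact hv s hs'

theorem norm_apply_sub_sub_le {x τ y : ℝ} (hx : c ≤ x) (hxτ : x ≤ τ) (hτy : τ ≤ y) (hy : y ≤ d)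
    (hFε : ∀ s ∈ Icc x y, ∀ s' ∈ Icc x y, ‖F s - F s'‖ ≤ ε) :
    ‖A τ (F y - F x) - ((A y (F y) - A x (F x)) - ∫ s in x..y, A' s (F s))‖ ≤
      C * ε * (y - x) := by
  have hxy := hxτ.trans hτy
  have hleft := norm_apply_sub_apply_sub_integral_le hA hA' hF hC hx hxτ (hτy.trans hy)
    fun s hs => hFε s ⟨hs.1, hs.2.trans hτy⟩ x (left_mem_Icc.2 hxy)
  have hright := norm_apply_sub_apply_sub_integral_le hA hA' hF hC (hx.trans hxτ) hτy hy
    fun s hs => hFε s ⟨hxτ.trans hs.1, hs.2⟩ y (right_mem_Icc.2 hxy)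
  have hint : ∀ {p q : ℝ}, c ≤ p → p ≤ q → q ≤ d →
      IntervalIntegrable (fun s => A' s (F s)) volume p q := fun hp hpq hq =>
    ((hA'.clm_apply hF).mono (Icc_subset_Icc hp hq)).intervalIntegrable_of_Icc hpq
  have hsplit : A τ (F y - F x) - ((A y (F y) - A x (F x)) - ∫ s in x..y, A' s (F s)) =
      -((A τ (F x) - A x (F x) - ∫ s in x..τ, A' s (F s)) +
        (A y (F y) - A τ (F y) - ∫ s in τ..y, A' s (F s))) := by
    rw [← intervalIntegral.integral_add_adjacent_intervals (hint hx hxτ (hτy.trans hy))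
      (hint (hx.trans hxτ) hτy hy), map_sub]
    abel
  rw [hsplit, norm_neg]
  refine (norm_add_le_of_le hleft hright).trans_eq ?_
  ring

end Increment

theorem mem_Icc_of_partition {N : ℕ} {x : ℕ → ℝ} (hx0 : x 0 = c) (hxN : x N = d)
    (hx : ∀ i < N, x i ≤ x (i + 1)) {i : ℕ} (hi : i ≤ N) : x i ∈ Icc c d := by
  have hmono : MonotoneOn x (Icc 0 N) :=
    monotoneOn_of_le_add_one ordConnected_Icc fun i _ _ hi => hx i hi.2
  exact ⟨hx0 ▸ hmono ⟨le_rfl, N.zero_le⟩ ⟨i.zero_le, hi⟩ i.zero_le,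
    hxN ▸ hmono ⟨i.zero_le, hi⟩ ⟨N.zero_le, le_rfl⟩ hi⟩

include hA hA' hF

theorem norm_stieltjes_sum_sub_le (hC : ∀ s ∈ Icc c d, ‖A' s‖ ≤ C) {δ : ℝ}
    (hδ : ∀ s ∈ Icc c d, ∀ s' ∈ Icc c d, dist s s' < δ → dist (F s) (F s') < ε) {N : ℕ}
    {x τ : ℕ → ℝ} (hx0 : x 0 = c) (hxN : x N = d)
    (hx : ∀ i < N, x i ≤ τ i ∧ τ i ≤ x (i + 1) ∧ x (i + 1) - x i < δ) :
    ‖(∑ i ∈ Finset.range N, A (τ i) (F (x (i + 1)) - F (x i))) -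
      ((A d (F d) - A c (F c)) - ∫ s in c..d, A' s (F s))‖ ≤ C * ε * (d - c) := by
  have hstep : ∀ i < N, x i ≤ x (i + 1) := fun i hi => (hx i hi).1.trans (hx i hi).2.1
  have hmem : ∀ i ≤ N, x i ∈ Icc c d := fun i hi => mem_Icc_of_partition hx0 hxN hstep hi
  have hint : ∀ i < N, IntervalIntegrable (fun s => A' s (F s)) volume (x i) (x (i + 1)) :=
    fun i hi => ((hA'.clm_apply hF).mono (Icc_subset_Icc (hmem i hi.le).1
      (hmem (i + 1) hi).2)).intervalIntegrable_of_Icc (hstep i hi)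
  have htelescope := Finset.sum_range_sub (fun i => A (x i) (F (x i))) N
  have hintegral := intervalIntegral.sum_integral_adjacent_intervals hint
  simp only [hx0, hxN] at htelescope hintegral
  rw [← hintegral, ← htelescope, ← Finset.sum_sub_distrib, ← Finset.sum_sub_distrib, ← hx0, ← hxN,
    ← Finset.sum_range_sub, Finset.mul_sum]
  refine norm_sum_le_of_le _ fun i hi => ?_
  have hi := Finset.mem_range.1 hi
  obtain ⟨hxτ, hτx, hmesh⟩ := hx i hi
  have hsub : Icc (x i) (x (i + 1)) ⊆ Icc c d := Icc_subset_Icc (hmem i hi.le).1 (hmem (i + 1) hi).2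
  refine norm_apply_sub_sub_le hA hA' hF hC (hmem i hi.le).1 hxτ hτx (hmem (i + 1) hi).2
    fun s hs s' hs' => ?_
  rw [← dist_eq_norm]
  exact (hδ s (hsub hs) s' (hsub hs') ((Real.dist_le_of_mem_Icc hs hs').trans_lt hmesh)).le

theorem exists_norm_stieltjes_sum_sub_lt (hcd : c ≤ d) (hε : 0 < ε) :
    ∃ δ > 0, ∀ (N : ℕ) (x τ : ℕ → ℝ), x 0 = c → x N = d →
      (∀ i < N, x i ≤ τ i ∧ τ i ≤ x (i + 1) ∧ x (i + 1) - x i < δ) →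
      ‖(∑ i ∈ Finset.range N, A (τ i) (F (x (i + 1)) - F (x i))) -
        ((A d (F d) - A c (F c)) - ∫ s in c..d, A' s (F s))‖ < ε := by
  obtain ⟨C, hC⟩ := isCompact_Icc.exists_bound_of_continuousOn hA'
  have : 0 ≤ C * (d - c) :=
    mul_nonneg ((norm_nonneg _).trans (hC c (left_mem_Icc.2 hcd))) (sub_nonneg.2 hcd)
  obtain ⟨ε', hε', hlt⟩ := exists_pos_mul_lt hε (C * (d - c))
  obtain ⟨δ, hδ, hFδ⟩ := Metric.uniformContinuousOn_iff.1
    (isCompact_Icc.uniformContinuousOn_of_continuous hF) ε' hε'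
  refine ⟨δ, hδ, fun N x τ hx0 hxN hx =>
    (norm_stieltjes_sum_sub_le hA hA' hF hC hFδ hx0 hxN hx).trans_lt ?_⟩
  rwa [mul_right_comm]

end Stieltjes

section AbsolutelyContinuous

variable {V W : Type*} [NormedAddCommGroup V] [NormedSpace ℝ V] [NormedAddCommGroup W]
  [NormedSpace ℝ W] {F : ℝ → V} {c d : ℝ}

theorem absolutelyContinuousOnInterval_of_dist_le {X Y Z : Type*} [PseudoMetricSpace X]
    [PseudoMetricSpace Y] [PseudoMetricSpace Z] {f : ℝ → X} {g : ℝ → Y} {h : ℝ → Z} {B C : ℝ}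
    (hf : AbsolutelyContinuousOnInterval f c d) (hg : AbsolutelyContinuousOnInterval g c d)
    (hle : ∀ x ∈ uIcc c d, ∀ y ∈ uIcc c d,
      dist (h x) (h y) ≤ B * dist (f x) (f y) + C * dist (g x) (g y)) :
    AbsolutelyContinuousOnInterval h c d := by
  unfold AbsolutelyContinuousOnInterval at hf hg ⊢
  have hlim := (hf.const_mul B).add (hg.const_mul C)
  rw [mul_zero, mul_zero, add_zero] at hlim
  refine squeeze_zero' (Eventually.of_forall fun E => Finset.sum_nonneg fun _ _ => dist_nonneg)
    ?_ hlim
  filter_upwards [mem_inf_of_right (mem_principal_self _)] with E hE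
  rw [Finset.mul_sum, Finset.mul_sum, ← Finset.sum_add_distrib]
  exact Finset.sum_le_sum fun i hi => hle _ (hE.1 i hi).1 _ (hE.1 i hi).2

theorem absolutelyContinuousOnInterval_clm_comp (hF : AbsolutelyContinuousOnInterval F c d)
    (L : V →L[ℝ] W) : AbsolutelyContinuousOnInterval (fun x => L (F x)) c d :=
  absolutelyContinuousOnInterval_of_dist_le (B := ‖L‖) (C := 0) hF hF fun x _ y _ => by
    simpa only [zero_mul, add_zero, coe_nnnorm] using L.lipschitz.dist_le_mul (F x) (F y)

theorem absolutelyContinuousOnInterval_clm_apply {A : ℝ → V →L[ℝ] W}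
    (hA : AbsolutelyContinuousOnInterval A c d) (hF : AbsolutelyContinuousOnInterval F c d) :
    AbsolutelyContinuousOnInterval (fun x => A x (F x)) c d := by
  obtain ⟨B, hB⟩ := hF.exists_bound
  obtain ⟨C, hC⟩ := hA.exists_bound
  refine absolutelyContinuousOnInterval_of_dist_le (B := B) (C := C) hA hF fun x hx y hy => ?_
  simp only [dist_eq_norm]
  calc ‖A x (F x) - A y (F y)‖ = ‖(A x - A y) (F x) + A y (F x - F y)‖ := by
        rw [_root_.sub_apply, map_sub, sub_add_sub_cancel]
    _ ≤ ‖A x - A y‖ * ‖F x‖ + ‖A y‖ * ‖F x - F y‖ :=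
        norm_add_le_of_le (ContinuousLinearMap.le_opNorm _ _) (ContinuousLinearMap.le_opNorm _ _)
    _ ≤ B * ‖A x - A y‖ + C * ‖F x - F y‖ := by
        rw [mul_comm B]
        gcongr
        exacts [hB x hx, hC y hy]

theorem absolutelyContinuousOnInterval_of_hasDerivWithinAt {F' : ℝ → V}
    (hF : ∀ s ∈ uIcc c d, HasDerivWithinAt F (F' s) (uIcc c d) s)
    (hF' : ContinuousOn F' (uIcc c d)) : AbsolutelyContinuousOnInterval F c d := by
  obtain ⟨C, hC⟩ := isCompact_uIcc.exists_bound_of_continuousOn hF'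
  refine LipschitzOnWith.absolutelyContinuousOnInterval (K := C.toNNReal) ?_
  exact (convex_uIcc c d).lipschitzOnWith_of_nnnorm_hasDerivWithin_le hF fun x hx =>
    NNReal.coe_le_coe.1 ((hC x hx).trans (Real.le_coe_toNNReal C))

variable [FiniteDimensional ℝ V]

theorem ae_differentiableAt_of_absolutelyContinuousOnInterval
    (hF : AbsolutelyContinuousOnInterval F c d) :
    ∀ᵐ x : ℝ, x ∈ uIcc c d → DifferentiableAt ℝ F x := by
  let e := (Module.finBasis ℝ V).equivFunL
  have hcoord : ∀ i, ∀ᵐ x : ℝ, x ∈ uIcc c d → DifferentiableAt ℝ (fun x => e (F x) i) x := fun i =>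
    (absolutelyContinuousOnInterval_clm_comp hF
      ((ContinuousLinearMap.proj i).comp e.toContinuousLinearMap)).ae_differentiableAt
  filter_upwards [ae_all_iff.2 hcoord] with x hx hxm
  exact e.comp_differentiableAt_iff.1 (differentiableAt_pi.2 fun i => hx i hxm)

theorem ae_deriv_clm_comp (hF : AbsolutelyContinuousOnInterval F c d) (L : V →L[ℝ] W) :
    ∀ᵐ x : ℝ, x ∈ uIoc c d → L (deriv F x) = deriv (fun x => L (F x)) x := by
  filter_upwards [ae_differentiableAt_of_absolutelyContinuousOnInterval hF] with x hx hxm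
  exact (L.hasFDerivAt.comp_hasDerivAt x (hx (uIoc_subset_uIcc hxm)).hasDerivAt).deriv.symm

theorem intervalIntegrable_deriv_of_absolutelyContinuousOnInterval
    (hF : AbsolutelyContinuousOnInterval F c d) : IntervalIntegrable (deriv F) volume c d := by
  let e := (Module.finBasis ℝ V).equivFunL
  have hcoord : ∀ i, IntervalIntegrable (fun x => e (deriv F x) i) volume c d := fun i => by
    let L : V →L[ℝ] ℝ := (ContinuousLinearMap.proj i).comp e.toContinuousLinearMap
    refine (absolutelyContinuousOnInterval_clm_comp hF L).intervalIntegrable_deriv.congr_ae ?_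
    rw [EventuallyEq, ae_restrict_iff' measurableSet_uIoc]
    filter_upwards [ae_deriv_clm_comp hF L] with x hx hxm
    exact (hx hxm).symm
  simp only [intervalIntegrable_iff, IntegrableOn] at hcoord ⊢
  simpa using e.symm.toContinuousLinearMap.integrable_comp (Integrable.of_eval hcoord)

theorem integral_deriv_of_absolutelyContinuousOnInterval
    (hF : AbsolutelyContinuousOnInterval F c d) : ∫ x in c..d, deriv F x = F d - F c := by
  have := FiniteDimensional.complete ℝ V
  refine (SeparatingDual.eq_iff_forall_dual_eq (R := ℝ)).2 fun L => ?_
  rw [← L.intervalIntegral_comp_comm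
      (intervalIntegrable_deriv_of_absolutelyContinuousOnInterval hF), map_sub,
    ← (absolutelyContinuousOnInterval_clm_comp hF L).integral_deriv_eq_sub]
  exact intervalIntegral.integral_congr_ae (ae_deriv_clm_comp hF L)

variable {A : ℝ → V →L[ℝ] W}

theorem intervalIntegrable_clm_apply_deriv (hA : ContinuousOn A (uIcc c d))
    (hF : AbsolutelyContinuousOnInterval F c d) :
    IntervalIntegrable (fun s => A s (deriv F s)) volume c d := by
  have hF' := intervalIntegrable_deriv_of_absolutelyContinuousOnInterval hF
  obtain ⟨C, hC⟩ := isCompact_uIcc.exists_bound_of_continuousOn hA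
  rw [intervalIntegrable_iff] at hF' ⊢
  refine (hF'.norm.const_mul C).mono' ?_ ?_
  · exact isBoundedBilinearMap_apply.continuous.comp_aestronglyMeasurable₂
      ((hA.mono uIoc_subset_uIcc).aestronglyMeasurable measurableSet_uIoc) hF'.1
  · exact (ae_restrict_iff' measurableSet_uIoc).2 (Eventually.of_forall fun s hs =>
      (A s).le_of_opNorm_le (hC s (uIoc_subset_uIcc hs)) _)

theorem integral_clm_apply_deriv [FiniteDimensional ℝ W] {A' : ℝ → V →L[ℝ] W}
    (hA : ∀ s ∈ uIcc c d, HasDerivWithinAt A (A' s) (uIcc c d) s)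
    (hA' : ContinuousOn A' (uIcc c d)) (hF : AbsolutelyContinuousOnInterval F c d) :
    ∫ s in c..d, A s (deriv F s) = (A d (F d) - A c (F c)) - ∫ s in c..d, A' s (F s) := by
  have hAF' := intervalIntegrable_clm_apply_deriv (fun s hs => (hA s hs).continuousWithinAt) hF
  have hA'F : IntervalIntegrable (fun s => A' s (F s)) volume c d :=
    (hA'.clm_apply hF.continuousOn).intervalIntegrable
  rw [← integral_deriv_of_absolutelyContinuousOnInterval
      (absolutelyContinuousOnInterval_clm_apply
        (absolutelyContinuousOnInterval_of_hasDerivWithinAt hA hA') hF),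
    eq_sub_iff_add_eq, ← intervalIntegral.integral_add hAF' hA'F]
  refine intervalIntegral.integral_congr_ae ?_
  filter_upwards [ae_differentiableAt_of_absolutelyContinuousOnInterval hF,
    Measure.ae_ne volume (max c d)] with s hs hsd hsm
  have hsF := (hs (uIoc_subset_uIcc hsm)).hasDerivAt
  have hsA := (hA s (uIoc_subset_uIcc hsm)).hasDerivAt
    (Icc_mem_nhds hsm.1 (hsm.2.lt_of_ne hsd))
  rw [(hsA.clm_apply hsF).deriv, add_comm]

end AbsolutelyContinuous

section Action

variable {a b : ℝ} {hab : a ≤ b} {𝔸 W : Type*} [NormedRing 𝔸] [NormedAlgebra ℝ 𝔸]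
  [NormedAddCommGroup W] [NormedSpace ℝ W]

/-- The operator kernel `(t, s) ↦ (w ↦ k(t, s) w)` on a space `W` on which the algebra `𝔸` acts
through `ρ`. -/
def actKernel (ρ : 𝔸 →L[ℝ] W →L[ℝ] W) (k : C(Icc a b × Icc a b, 𝔸)) :
    C(Icc a b × Icc a b, W →L[ℝ] W) :=
  ⟨fun p => ρ (k p), by fun_prop⟩

/-- The operator kernel `(t, s) ↦ (x ↦ x k(s, t))` of the adjoint equation. -/
def rightKernel (k : C(Icc a b × Icc a b, 𝔸)) : C(Icc a b × Icc a b, 𝔸 →L[ℝ] 𝔸) :=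
  ⟨fun p => (ContinuousLinearMap.mul ℝ 𝔸).flip (k p.swap), by fun_prop⟩

variable {k : C(Icc a b × Icc a b, 𝔸)} {ρ : 𝔸 →L[ℝ] W →L[ℝ] W}
  (hρ : ∀ x y w, ρ (x * y) w = ρ x (ρ y w))
include hρ

theorem isAdjointKernel_rightKernel_actKernel :
    IsAdjointKernel ρ (rightKernel k) (actKernel ρ k) :=
  fun _ _ _ _ => hρ _ _ _

theorem isAdjointKernel_actKernel_rightKernel :
    IsAdjointKernel ρ.flip (actKernel ρ k) (rightKernel k) :=
  fun _ _ _ _ => (hρ _ _ _).symm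

theorem isRegular_actKernel [CompleteSpace 𝔸] [FiniteDimensional ℝ W] (hρ1 : ∀ w, ρ 1 w = w)
    (hk : IsRegular hab (rightKernel k)) : IsRegular hab (actKernel ρ k) := fun ξ hξ =>
  have := FiniteDimensional.complete ℝ W
  isUnit_one_sub_truncOp_adjoint (isAdjointKernel_actKernel_rightKernel hρ)
    (fun w hw => (hρ1 w).symm.trans (hw 1)) hξ.1 (hk ξ hξ)

omit hρ in
theorem isRegular_rightKernel [FiniteDimensional ℝ 𝔸]
    (hk : IsRegular hab (actKernel (ContinuousLinearMap.mul ℝ 𝔸) k)) :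
    IsRegular hab (rightKernel k) := fun ξ hξ =>
  have := FiniteDimensional.complete ℝ 𝔸
  isUnit_one_sub_truncOp_adjoint (isAdjointKernel_rightKernel_actKernel mul_assoc)
    (fun x hx => (mul_one x).symm.trans (hx 1)) hξ.1 (hk ξ hξ)

end Action

section Equations

variable {n : ℕ} {a b : ℝ} {K : ℝ → ℝ → Matrix (Fin n) (Fin n) ℂ}

variable (n) in
/-- The action of matrices on vectors as a continuous bilinear map. -/
def mulVecL : Matrix (Fin n) (Fin n) ℂ →L[ℝ] (Fin n → ℂ) →L[ℝ] (Fin n → ℂ) :=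
  (Matrix.mulVecBilin ℝ ℝ).toContinuousBilinearMap

theorem mulVecL_mul (A B : Matrix (Fin n) (Fin n) ℂ) (v : Fin n → ℂ) :
    mulVecL n (A * B) v = mulVecL n A (mulVecL n B v) :=
  (Matrix.mulVec_mulVec v A B).symm

theorem mulVecL_one (v : Fin n → ℂ) : mulVecL n 1 v = v := Matrix.one_mulVec v

variable (hK : ContinuousOn (fun p : ℝ × ℝ => K p.1 p.2) (Icc a b ×ˢ Icc a b))

/-- The kernel `K`, restricted to the square on which it is continuous. -/
def kernelMap : C(Icc a b × Icc a b, Matrix (Fin n) (Fin n) ℂ) :=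
  ⟨fun p => K p.1 p.2,
    hK.comp_continuous (f := fun p : Icc a b × Icc a b => ((p.1 : ℝ), (p.2 : ℝ))) (by fun_prop)
      fun p => ⟨p.1.2, p.2.2⟩⟩

/-- The operator kernel of the first truncated equation. -/
abbrev leftKernel : C(Icc a b × Icc a b,
    Matrix (Fin n) (Fin n) ℂ →L[ℝ] Matrix (Fin n) (Fin n) ℂ) :=
  actKernel (ContinuousLinearMap.mul ℝ _) (kernelMap hK)

/-- The operator kernel of the second, adjoint truncated equation. -/
abbrev starKernel : C(Icc a b × Icc a b,
    Matrix (Fin n) (Fin n) ℂ →L[ℝ] Matrix (Fin n) (Fin n) ℂ) :=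
  rightKernel (kernelMap hK)

/-- The operator kernel of the system for the vector unknown `φ`. -/
abbrev vecKernel : C(Icc a b × Icc a b, (Fin n → ℂ) →L[ℝ] (Fin n → ℂ)) :=
  actKernel (mulVecL n) (kernelMap hK)

variable {hK} {hab : a ≤ b} {ξ : ℝ} {h : ℝ → Matrix (Fin n) (Fin n) ℂ}

section Solutions

variable (hξ : ξ ∈ Icc a b)
include hξ

theorem IsTruncSol.eq_truncRes (hh : IsTruncSol K a ξ h) (hk : IsRegular hab (leftKernel hK))
    {t : ℝ} (ht : t ∈ Icc a ξ) :
    h t = truncRes hab (leftKernel hK) ξ (.const _ 1) (projIcc a b hab t) :=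
  IsIntegralSol.eq_truncRes (κ := fun t s => .mul ℝ _ (K t s)) (q := fun _ => 1)
    (fun _ _ => rfl) hξ (fun _ => rfl) (hk ξ hξ) hh ht

theorem IsTruncSolStar.eq_truncRes (hh : IsTruncSolStar K a ξ h)
    (hk : IsRegular hab (starKernel hK)) {t : ℝ} (ht : t ∈ Icc a ξ) :
    h t = truncRes hab (starKernel hK) ξ (.const _ 1) (projIcc a b hab t) :=
  IsIntegralSol.eq_truncRes
    (κ := fun t s => (ContinuousLinearMap.mul ℝ (Matrix (Fin n) (Fin n) ℂ)).flip (K s t))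
    (q := fun _ => 1) (fun _ _ => rfl) hξ (fun _ => rfl) (hk ξ hξ) hh ht

theorem isTruncSolStar_truncRes (hk : IsRegular hab (starKernel hK)) :
    IsTruncSolStar K a ξ
      fun t => truncRes hab (starKernel hK) ξ (.const _ 1) (projIcc a b hab t) :=
  isIntegralSol_truncRes
    (κ := fun t s => (ContinuousLinearMap.mul ℝ (Matrix (Fin n) (Fin n) ℂ)).flip (K s t))
    (q := fun _ => 1) (fun _ _ => rfl) hξ (fun _ => rfl) (hk ξ hξ)

end Solutions

section System

variable {f φ : ℝ → Fin n → ℂ} {fc : C(Icc a b, Fin n → ℂ)} (hk : IsRegular hab (vecKernel hK))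
  (hf : ∀ t, fc t = f t)
include hk hf

theorem isSystemSol_truncRes :
    IsSystemSol K a b f fun t => truncRes hab (vecKernel hK) b fc (projIcc a b hab t) :=
  isIntegralSol_truncRes (κ := fun t s => mulVecL n (K t s)) (fun _ _ => rfl)
    (right_mem_Icc.2 hab) hf (hk b (right_mem_Icc.2 hab))

theorem IsSystemSol.eq_truncRes (hφ : IsSystemSol K a b f φ) {t : ℝ} (ht : t ∈ Icc a b) :
    φ t = truncRes hab (vecKernel hK) b fc (projIcc a b hab t) :=
  IsIntegralSol.eq_truncRes (κ := fun t s => mulVecL n (K t s)) (fun _ _ => rfl)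
    (right_mem_Icc.2 hab) hf (hk b (right_mem_Icc.2 hab)) hφ ht

end System

theorem isRegular_leftKernel {g : ℝ → ℝ → Matrix (Fin n) (Fin n) ℂ}
    (hg : ∀ ξ ∈ Icc a b, IsTruncSol K a ξ fun t => g t ξ)
    (huniq : ∀ ξ ∈ Ioc a b, ∀ h, IsTruncSol K a ξ h → EqOn h (fun t => g t ξ) (Icc a ξ)) :
    IsRegular hab (leftKernel hK) := fun ξ hξ =>
  isUnit_one_sub_truncOp_of_unique (κ := fun t s => .mul ℝ _ (K t s)) (q := fun _ => 1)
    (fun _ _ => rfl) hξ (hg ξ hξ) fun h hh _ hs =>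
      huniq ξ ⟨hs.1.trans_le hs.2, hξ.2⟩ h hh ⟨hs.1.le, hs.2⟩

theorem isRegular_vecKernel (hk : IsRegular hab (leftKernel hK)) : IsRegular hab (vecKernel hK) :=
  isRegular_actKernel mulVecL_mul mulVecL_one (isRegular_rightKernel hk)

end Equations

section Formula

variable {n : ℕ} {a b : ℝ} (hlt : a < b) {K : ℝ → ℝ → Matrix (Fin n) (Fin n) ℂ}
  {hK : ContinuousOn (fun p : ℝ × ℝ => K p.1 p.2) (Icc a b ×ˢ Icc a b)} {hab : a ≤ b}
  {g gs : ℝ → ℝ → Matrix (Fin n) (Fin n) ℂ} {f : ℝ → Fin n → ℂ} {fc : C(Icc a b, Fin n → ℂ)}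
  {t ξ : ℝ} (hk : IsRegular hab (leftKernel hK))
  (hg : ∀ ξ ∈ Icc a b, IsTruncSol K a ξ fun t => g t ξ)
  (hgs : ∀ ξ ∈ Icc a b, IsTruncSolStar K a ξ fun t => gs t ξ)
  (hdet : ∀ ξ ∈ Icc a b, (gs ξ ξ * g ξ ξ).det ≠ 0) (hf : ∀ t, fc t = f t)
include hk

section Solution

include hg

theorem truncSol_diag_eq_truncRes (hξ : ξ ∈ Icc a b) :
    g ξ ξ = truncRes hab (leftKernel hK) ξ (.const _ 1) (projIcc a b hab ξ) :=
  (hg ξ hξ).eq_truncRes hξ hk (right_mem_Icc.2 hξ.1)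

theorem continuousOn_truncSol_diag : ContinuousOn (fun ξ => g ξ ξ) (Icc a b) :=
  (continuousOn_truncRes_apply_diag hk (.const _ 1)).congr fun _ hξ =>
    truncSol_diag_eq_truncRes hk hg hξ

theorem hasDerivWithinAt_truncSol (ht : t ∈ Icc a b) (hξ : ξ ∈ Icc t b) :
    HasDerivWithinAt (g t) (resolventColumn hab (leftKernel hK) ξ (g ξ ξ) (projIcc a b hab t))
      (Icc t b) ξ := by
  have hsub : Icc t b ⊆ Icc a b := Icc_subset_Icc_left ht.1
  have hderiv := hasDerivWithinAt_truncRes_apply_apply hk (.const _ 1) (projIcc a b hab t) (hsub hξ)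
  rw [truncSol_diag_eq_truncRes hk hg (hsub hξ)]
  exact (hderiv.mono hsub).congr_of_mem
    (fun η hη => (hg η (hsub hη)).eq_truncRes (hsub hη) hk ⟨ht.1, hη.1⟩) hξ

theorem continuousOn_resolventColumn_truncSol_diag (t : Icc a b) :
    ContinuousOn (fun ξ => resolventColumn hab (leftKernel hK) ξ (g ξ ξ) t) (Icc a b) :=
  (continuousOn_resolventColumn_truncRes_diag hk (.const _ 1) t).congr fun ξ hξ =>
    congrArg (resolventColumn hab (leftKernel hK) ξ · t) (truncSol_diag_eq_truncRes hk hg hξ)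

theorem hasDerivWithinAt_mulVecL_truncSol (ht : t ∈ Icc a b) (hξ : ξ ∈ Icc t b) :
    HasDerivWithinAt (fun ξ => mulVecL n (g t ξ))
      (mulVecL n (resolventColumn hab (leftKernel hK) ξ (g ξ ξ) (projIcc a b hab t))) (Icc t b) ξ :=
  (mulVecL n).hasFDerivAt.comp_hasDerivWithinAt ξ (hasDerivWithinAt_truncSol hk hg ht hξ)

theorem continuousOn_mulVecL_resolventColumn (ht : t ∈ Icc a b) :
    ContinuousOn (fun ξ => mulVecL n
      (resolventColumn hab (leftKernel hK) ξ (g ξ ξ) (projIcc a b hab t))) (Icc t b) :=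
  (mulVecL n).continuous.comp_continuousOn
    ((continuousOn_resolventColumn_truncSol_diag hk hg _).mono (Icc_subset_Icc_left ht.1))

end Solution

include hgs

section DerivM

include hg

theorem hasDerivWithinAt_M (hξ : ξ ∈ Icc a b) :
    HasDerivWithinAt (M a g) (gs ξ ξ * g ξ ξ) (Icc a b) ξ := by
  have hstar := isRegular_rightKernel hk
  rw [truncSol_diag_eq_truncRes hk hg hξ, (hgs ξ hξ).eq_truncRes hξ hstar (right_mem_Icc.2 hξ.1)]
  refine (hasDerivWithinAt_integral_truncRes (isAdjointKernel_rightKernel_actKernel mul_assoc)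
    one_mul hstar hk (.const _ 1) hξ).congr_of_mem (fun η hη => ?_) hξ
  exact intervalIntegral.integral_congr fun t ht =>
    (hg η hη).eq_truncRes hη hk (uIcc_of_le hη.1 ▸ ht)

include hlt in
theorem M'_eq (hξ : ξ ∈ Icc a b) : M' a b g ξ = gs ξ ξ * g ξ ξ :=
  (hasDerivWithinAt_M hk hg hgs hξ).derivWithin (uniqueDiffOn_Icc hlt ξ hξ)

end DerivM

include hf

theorem G_eq_integral_truncRes (hξ : ξ ∈ Icc a b) :
    G a gs f ξ = ∫ t in a..ξ, truncRes hab (vecKernel hK) ξ fc (projIcc a b hab t) := by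
  have hstar := isRegular_rightKernel hk
  rw [← integral_pairing_truncRes_const (isAdjointKernel_rightKernel_actKernel mulVecL_mul)
    mulVecL_one (hstar ξ hξ) (isRegular_vecKernel hk ξ hξ)]
  refine intervalIntegral.integral_congr fun t ht => ?_
  rw [uIcc_of_le hξ.1] at ht
  rw [← (hgs ξ hξ).eq_truncRes hξ hstar ht, hf, projIcc_of_mem hab ⟨ht.1, ht.2.trans hξ.2⟩]
  rfl

theorem hasDerivWithinAt_G (hξ : ξ ∈ Icc a b) :
    HasDerivWithinAt (G a gs f) (gs ξ ξ *ᵥ truncRes hab (vecKernel hK) ξ fc (projIcc a b hab ξ))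
      (Icc a b) ξ := by
  have hstar := isRegular_rightKernel hk
  rw [(hgs ξ hξ).eq_truncRes hξ hstar (right_mem_Icc.2 hξ.1)]
  exact (hasDerivWithinAt_integral_truncRes (isAdjointKernel_rightKernel_actKernel mulVecL_mul)
    mulVecL_one hstar (isRegular_vecKernel hk) fc hξ).congr_of_mem
    (fun _ hη => G_eq_integral_truncRes hk hgs hf hη) hξ

include hlt hg hdet

theorem F_eq (hξ : ξ ∈ Icc a b) :
    F a b g gs f ξ = (g ξ ξ)⁻¹ *ᵥ truncRes hab (vecKernel hK) ξ fc (projIcc a b hab ξ) := by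
  have hd := Matrix.det_mul (gs ξ ξ) (g ξ ξ) ▸ hdet ξ hξ
  rw [F, M'_eq hlt hk hg hgs hξ, G',
    (hasDerivWithinAt_G hk hgs hf hξ).derivWithin (uniqueDiffOn_Icc hlt ξ hξ), Matrix.mul_inv_rev,
    Matrix.mulVec_mulVec, Matrix.mul_assoc,
    Matrix.nonsing_inv_mul _ (left_ne_zero_of_mul hd).isUnit, Matrix.mul_one]

theorem mulVec_F (hξ : ξ ∈ Icc a b) :
    g ξ ξ *ᵥ F a b g gs f ξ = truncRes hab (vecKernel hK) ξ fc (projIcc a b hab ξ) := by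
  have hd := Matrix.det_mul (gs ξ ξ) (g ξ ξ) ▸ hdet ξ hξ
  rw [F_eq hlt hk hg hgs hdet hf hξ, Matrix.mulVec_mulVec,
    Matrix.mul_nonsing_inv _ (right_ne_zero_of_mul hd).isUnit, Matrix.one_mulVec]

theorem continuousOn_F : ContinuousOn (F a b g gs f) (Icc a b) := by
  have hinv : ContinuousOn (fun ξ => (g ξ ξ)⁻¹) (Icc a b) := fun ξ hξ => by
    have hd := Matrix.det_mul (gs ξ ξ) (g ξ ξ) ▸ hdet ξ hξ
    obtain ⟨x, hx⟩ := (Matrix.isUnit_iff_isUnit_det (g ξ ξ)).2 (right_ne_zero_of_mul hd).isUnit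
    have hinv_at : ContinuousAt Ring.inverse (g ξ ξ) := hx ▸ NormedRing.inverse_continuousAt x
    simp only [Matrix.nonsing_inv_eq_ringInverse]
    exact hinv_at.comp_continuousWithinAt (f := fun ξ => g ξ ξ)
      (continuousOn_truncSol_diag hk hg ξ hξ)
  exact (((mulVecL n).continuous.comp_continuousOn hinv).clm_apply
    (continuousOn_truncRes_apply_diag (isRegular_vecKernel hk) fc)).congr
      fun _ hξ => F_eq hlt hk hg hgs hdet hf hξ

theorem truncRes_eq_sub_integral (ht : t ∈ Icc a b) :
    truncRes hab (vecKernel hK) b fc (projIcc a b hab t) = g t b *ᵥ F a b g gs f b -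
      ((mulVecL n (g t b) (F a b g gs f b) - mulVecL n (g t t) (F a b g gs f t)) -
        ∫ ξ in t..b, mulVecL n (resolventColumn hab (leftKernel hK) ξ (g ξ ξ) (projIcc a b hab t))
          (F a b g gs f ξ)) := by
  have hkrein := truncRes_sub_truncRes_eq_integral hk (isRegular_vecKernel hk) (B := mulVecL n)
    (fun _ _ _ => mulVecL_mul _ _ _) (X := fun ξ => g ξ ξ) (F := F a b g gs f)
    (fun _ hξ => mulVec_F hlt hk hg hgs hdet hf hξ) ⟨t, ht⟩
  have hdiag : mulVecL n (g t t) (F a b g gs f t) = _ := mulVec_F hlt hk hg hgs hdet hf ht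
  rw [projIcc_of_mem hab ht] at hdiag ⊢
  rw [← hkrein, ← hdiag]
  change _ = mulVecL n _ _ - _
  abel

theorem exists_isStieltjesIntegral (ht : t ∈ Icc a b) :
    ∃ J : Fin n → ℂ, IsStieltjesIntegral (g t) (F a b g gs f) t b J ∧
      truncRes hab (vecKernel hK) b fc (projIcc a b hab t) = g t b *ᵥ F a b g gs f b - J :=
  ⟨_, fun _ hε => exists_norm_stieltjes_sum_sub_lt
    (fun _ hξ => hasDerivWithinAt_mulVecL_truncSol hk hg ht hξ)
    (continuousOn_mulVecL_resolventColumn hk hg ht)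
    ((continuousOn_F hlt hk hg hgs hdet hf).mono (Icc_subset_Icc_left ht.1)) ht.2 hε,
    truncRes_eq_sub_integral hlt hk hg hgs hdet hf ht⟩

theorem truncRes_eq_sub_integral_derivWithin
    (hF : AbsolutelyContinuousOnInterval (F a b g gs f) a b) (ht : t ∈ Icc a b) :
    IntervalIntegrable (fun ξ => g t ξ *ᵥ derivWithin (F a b g gs f) (Icc a b) ξ) volume t b ∧
      truncRes hab (vecKernel hK) b fc (projIcc a b hab t) = g t b *ᵥ F a b g gs f b -
        ∫ ξ in t..b, g t ξ *ᵥ derivWithin (F a b g gs f) (Icc a b) ξ := by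
  have huIcc := uIcc_of_le ht.2
  have hA := fun ξ hξ => hasDerivWithinAt_mulVecL_truncSol hk hg ht (ξ := ξ) hξ
  have hA' := continuousOn_mulVecL_resolventColumn hk hg ht
  rw [← huIcc] at hA hA'
  have hFt : AbsolutelyContinuousOnInterval (F a b g gs f) t b :=
    hF.mono (uIcc_subset_uIcc_right (Icc_subset_uIcc ht))
  have hae : ∀ᵐ ξ : ℝ, ξ ∈ uIoc t b → mulVecL n (g t ξ) (deriv (F a b g gs f) ξ) =
      g t ξ *ᵥ derivWithin (F a b g gs f) (Icc a b) ξ := by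
    filter_upwards [Measure.ae_ne volume b] with ξ hξb hξ
    rw [uIoc_of_le ht.2] at hξ
    rw [derivWithin_of_mem_nhds (Icc_mem_nhds (ht.1.trans_lt hξ.1) (hξ.2.lt_of_ne hξb))]
    rfl
  refine ⟨(intervalIntegrable_clm_apply_deriv (fun ξ hξ => (hA ξ hξ).continuousWithinAt)
    hFt).congr_ae ((ae_restrict_iff' measurableSet_uIoc).2 hae), ?_⟩
  rw [← intervalIntegral.integral_congr_ae hae, integral_clm_apply_deriv hA hA' hFt]
  exact truncRes_eq_sub_integral hlt hk hg hgs hdet hf ht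

end Formula

end KreinSystem

end

theorem theorem3p1 {n : ℕ} {a b : ℝ} (hab : a < b)
    (K : ℝ → ℝ → Matrix (Fin n) (Fin n) ℂ)
    (hK : ContinuousOn (fun p : ℝ × ℝ => K p.1 p.2) (Icc a b ×ˢ Icc a b))
    (g : ℝ → ℝ → Matrix (Fin n) (Fin n) ℂ)
    (hg : ∀ ξ ∈ Icc a b, KreinSystem.IsTruncSol K a ξ (fun t => g t ξ))
    (hg_unique : ∀ ξ ∈ Ioc a b, ∀ h : ℝ → Matrix (Fin n) (Fin n) ℂ,
      KreinSystem.IsTruncSol K a ξ h → EqOn h (fun t => g t ξ) (Icc a ξ)) :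
    -- the adjoint truncated equations are then uniquely solvable as well
    (∀ ξ ∈ Ioc a b, ∃ h : ℝ → Matrix (Fin n) (Fin n) ℂ, KreinSystem.IsTruncSolStar K a ξ h ∧
      ∀ h' : ℝ → Matrix (Fin n) (Fin n) ℂ,
        KreinSystem.IsTruncSolStar K a ξ h' → EqOn h' h (Icc a ξ)) ∧
    ∀ gs : ℝ → ℝ → Matrix (Fin n) (Fin n) ℂ,
      (∀ ξ ∈ Icc a b, KreinSystem.IsTruncSolStar K a ξ (fun t => gs t ξ)) →
      (∀ ξ ∈ Icc a b, (gs ξ ξ * g ξ ξ).det ≠ 0) →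
      -- `M` is differentiable with invertible derivative
      DifferentiableOn ℝ (KreinSystem.M a g) (Icc a b) ∧
      (∀ ξ ∈ Icc a b, IsUnit (KreinSystem.M' a b g ξ)) ∧
      ∀ f : ℝ → Fin n → ℂ, ContinuousOn f (Icc a b) →
        DifferentiableOn ℝ (KreinSystem.G a gs f) (Icc a b) ∧
        ∃ φ : ℝ → Fin n → ℂ, KreinSystem.IsSystemSol K a b f φ ∧
          (∀ ψ : ℝ → Fin n → ℂ, KreinSystem.IsSystemSol K a b f ψ → EqOn ψ φ (Icc a b)) ∧
          -- the formula, with the outer derivative read in the Stieltjes sense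
          (∀ t ∈ Icc a b, ∃ J : Fin n → ℂ,
            KreinSystem.IsStieltjesIntegral (fun ξ => g t ξ) (KreinSystem.F a b g gs f) t b J ∧
            φ t = g t b *ᵥ ((KreinSystem.M' a b g b)⁻¹ *ᵥ KreinSystem.G' a b gs f b) - J) ∧
          -- the formula, with an honest outer derivative, whenever `F` is absolutely continuous
          (AbsolutelyContinuousOnInterval (KreinSystem.F a b g gs f) a b →
            (∀ᵐ ξ ∂(volume.restrict (Icc a b)),
              DifferentiableWithinAt ℝ (KreinSystem.F a b g gs f) (Icc a b) ξ) ∧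
            ∀ t ∈ Icc a b,
              IntervalIntegrable
                (fun ξ => g t ξ *ᵥ derivWithin (KreinSystem.F a b g gs f) (Icc a b) ξ)
                volume t b ∧
              φ t = g t b *ᵥ ((KreinSystem.M' a b g b)⁻¹ *ᵥ KreinSystem.G' a b gs f b)
                - ∫ ξ in t..b,
                    g t ξ *ᵥ derivWithin (KreinSystem.F a b g gs f) (Icc a b) ξ) := by
  have hk : KreinSystem.IsRegular hab.le (KreinSystem.leftKernel hK) :=
    KreinSystem.isRegular_leftKernel hg hg_unique
  have hstar := KreinSystem.isRegular_rightKernel hk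
  refine ⟨fun ξ hξ => ?_, fun gs hgs hdet => ⟨fun ξ hξ => ?_, fun ξ hξ => ?_, fun f hf => ?_⟩⟩
  · have hξ' := Ioc_subset_Icc_self hξ
    exact ⟨_, KreinSystem.isTruncSolStar_truncRes hξ' hstar,
      fun h' hh' t ht => hh'.eq_truncRes hξ' hstar ht⟩
  · exact (KreinSystem.hasDerivWithinAt_M hk hg hgs hξ).differentiableWithinAt
  · rw [KreinSystem.M'_eq hab hk hg hgs hξ, Matrix.isUnit_iff_isUnit_det]
    exact (hdet ξ hξ).isUnit
  · let fc : C(Icc a b, Fin n → ℂ) := ⟨fun t => f t, hf.domRestrict⟩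
    have hfc : ∀ t, fc t = f t := fun _ => rfl
    have hvec := KreinSystem.isRegular_vecKernel hk
    refine ⟨fun ξ hξ => (KreinSystem.hasDerivWithinAt_G hk hgs hfc hξ).differentiableWithinAt,
      _, KreinSystem.isSystemSol_truncRes hvec hfc, fun ψ hψ t ht => hψ.eq_truncRes hvec hfc ht,
      fun t ht => KreinSystem.exists_isStieltjesIntegral hab hk hg hgs hdet hfc ht,
      fun hF => ⟨(ae_restrict_iff' measurableSet_Icc).2 ?_, fun t ht =>
        KreinSystem.truncRes_eq_sub_integral_derivWithin hab hk hg hgs hdet hfc hF ht⟩⟩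
    filter_upwards [KreinSystem.ae_differentiableAt_of_absolutelyContinuousOnInterval hF]
      with ξ hξ hξm
    exact (hξ (Icc_subset_uIcc hξm)).differentiableWithinAt
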